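/- For a finite simple graph $G$ with vertex degrees $d_G(u)$, let \[\chi(G)=\sum_{uv\in E(G)}\frac{1}{\sqrt{d_G(u)+d_G(v)}}\] be its sum-connectivity index. A connected graph with $n$ vertices and $n+1$ edges is called bicyclic; let $\mathbb{B}(n)$ be the set of bicyclic graphs on $n$ vertices. Let $C_m$ denote the cycle on $m\ge 3$ vertices. Up to isomorphism, let - $\mathbf{B}_1^{(1)}(n)$ ($n\ge 6$) be the set of graphs obtained by joining two vertex-disjoint cycles $C_a$ and $C_b$ with $a+b=n$ by an edge; - $\mathbf{B}_1^{(2)}(n)$ ($n\ge 7$) be the set of graphs obtained by joining two vertex-disjoint cycles $C_a$ and $C_b$ with $a+b<n$ by a path of length $n-a-b+1$; - $\mathbf{B}_3^{(1)}(n)$ ($n\ge 4$) be the set of graphs obtained from $C_n$ by adding an edge; - $\mathbf{B}_3^{(2)}(n)$ ($n\ge 5$) be the set of graphs obtained by joining two non-adjacent vertices of $C_a$, where $4\le a\le n-1$, by a path of length $n-a+1$. (Here $\mathbf{B}_1^{(1)}(5)=\mathbf{B}_1^{(2)}(5)=\mathbf{B}_1^{(2)}(6)=\emptyset$.) Each of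 these families is non-empty in the indicated range of $n$. The second maximum of $\chi$ on $\mathbb{B}(n)$ is its largest value on $\mathbb{B}(n)$ that is different from the maximum. **Theorem.** Let $n\ge 5$. 1. If $n=5$, then the graphs in $\mathbb{B}(5)$ with the maximum $\chi$ are exactly those in $\mathbf{B}_3^{(1)}(5)$, and those with the second maximum $\chi$ are exactly those in $\mathbf{B}_3^{(2)}(5)$; each of these two sets consists of a single graph up to isomorphism. 2. If $n=6$, then the graphs in $\mathbb{B}(6)$ with the maximum $\chi$ are exactly those in $\mathbf{B}_1^{(1)}(6)\cup\mathbf{B}_3^{(1)}(6)$, and those with the second maximum $\chi$ are exactly those in $\mathbf{B}_3^{(2)}(6)$, which consists of a single graph up to isomorphism. 3. If $n\ge 7$, then the graphs in $\mathbb{B}(n)$ with the maximum $\chi$ are exactly those in $\mathbf{B}_1^{(1)}(n)\cup\mathbf{B}_3^{(1)}(n)$, and those with the second maximum $\chi$ are exactly those in $\mathbf{B}_1^{(2)}(n)\cup\mathbf{B}_3^{(2)}(n)$. Moreover, $\chi(G)=\frac{n-4}{2}+\frac{1}{\sqrt6}+\frac{4}{\sqrt5}$ for every $G\in\mathbf{B}_1^{(1)}(n)\cup\mathbf{B}_3^{(1)}(n)$,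 and $\chi(H)=\frac{n-5}{2}+\frac{6}{\sqrt5}$ for every $H\in\mathbf{B}_1^{(2)}(n)\cup\mathbf{B}_3^{(2)}(n)$. -/

import Mathlib

/-- The sum-connectivity index `χ(G) = ∑_{uv ∈ E(G)} 1 / √(d(u) + d(v))` of a finite simple graph. -/
noncomputable def sumConnectivityIndex {V : Type*} [Fintype V] (G : SimpleGraph V) : ℝ :=
  open Classical in
  ∑ e ∈ G.edgeFinset,
    Sym2.lift ⟨fun u v => 1 / √((G.degree u : ℝ) + (G.degree v : ℝ)),
      fun u v => by simp only [add_comm]⟩ e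

/-- The bicyclic graphs on `n` vertices: connected, with exactly `n + 1` edges. -/
def bicyclicGraphs (n : ℕ) : Set (SimpleGraph (Fin n)) :=
  {G | G.Connected ∧ G.edgeSet.ncard = n + 1}

/-- The vertices, in order, of a path from `x` to `y` with `k` new interior vertices. -/
def pathVertices {W : Type*} (x y : W) (k : ℕ) : Fin (k + 2) → W ⊕ Fin k :=
  Fin.cons (Sum.inl x) (Fin.snoc (α := fun _ => W ⊕ Fin k) Sum.inr (Sum.inl y))

/-- The graph obtained from `G` by joining its vertices `x` and `y` by a path of length `k + 1`,
whose `k` interior vertices are new. For `k = 0` this adds the edge `xy`. -/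
def joinByPath {W : Type*} (G : SimpleGraph W) (x y : W) (k : ℕ) : SimpleGraph (W ⊕ Fin k) :=
  G.map Function.Embedding.inl ⊔
    SimpleGraph.fromEdgeSet
      {e | ∃ i : Fin (k + 1), e = s(pathVertices x y k i.castSucc, pathVertices x y k i.succ)}

/-- `B₁⁽¹⁾(n)`: two vertex-disjoint cycles `C_a`, `C_b` with `a + b = n`, joined by an edge. -/
def familyB11 (n : ℕ) : Set (SimpleGraph (Fin n)) :=
  {G | ∃ a b : ℕ, 3 ≤ a ∧ 3 ≤ b ∧ a + b = n ∧ ∃ (u : Fin a) (v : Fin b),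
    Nonempty (G ≃g joinByPath (SimpleGraph.cycleGraph a ⊕g SimpleGraph.cycleGraph b)
      (Sum.inl u) (Sum.inr v) 0)}

/-- `B₁⁽²⁾(n)`: two vertex-disjoint cycles `C_a`, `C_b` with `a + b < n`, joined by a path of
length `n - a - b + 1`. -/
def familyB12 (n : ℕ) : Set (SimpleGraph (Fin n)) :=
  {G | ∃ a b : ℕ, 3 ≤ a ∧ 3 ≤ b ∧ a + b < n ∧ ∃ (u : Fin a) (v : Fin b),
    Nonempty (G ≃g joinByPath (SimpleGraph.cycleGraph a ⊕g SimpleGraph.cycleGraph b)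
      (Sum.inl u) (Sum.inr v) (n - a - b))}

/-- `B₃⁽¹⁾(n)`: the cycle `C_n` with one added edge. -/
def familyB31 (n : ℕ) : Set (SimpleGraph (Fin n)) :=
  {G | 4 ≤ n ∧ ∃ x y : Fin n, x ≠ y ∧ ¬ (SimpleGraph.cycleGraph n).Adj x y ∧
    Nonempty (G ≃g SimpleGraph.cycleGraph n ⊔ SimpleGraph.edge x y)}

/-- `B₃⁽²⁾(n)`: a cycle `C_a` with `4 ≤ a ≤ n - 1`, two of whose non-adjacent vertices are joined
by a path of length `n - a + 1`. -/
def familyB32 (n : ℕ) : Set (SimpleGraph (Fin n)) :=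
  {G | ∃ a : ℕ, 4 ≤ a ∧ a < n ∧ ∃ x y : Fin a, x ≠ y ∧ ¬ (SimpleGraph.cycleGraph a).Adj x y ∧
    Nonempty (G ≃g joinByPath (SimpleGraph.cycleGraph a) x y (n - a))}

/-- The graphs in `S` whose sum-connectivity index is maximum among the graphs in `S`. -/
def indexMaximizers {V : Type*} [Fintype V] (S : Set (SimpleGraph V)) : Set (SimpleGraph V) :=
  {G | G ∈ S ∧ ∀ H ∈ S, sumConnectivityIndex H ≤ sumConnectivityIndex G}

/-- The graphs in `S` whose sum-connectivity index is the second maximum among the graphs in `S`,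
that is, the largest value that is different from the maximum. -/
def indexSecondMaximizers {V : Type*} [Fintype V] (S : Set (SimpleGraph V)) :
    Set (SimpleGraph V) :=
  indexMaximizers (S \ indexMaximizers S)

/-- All graphs in `S` are isomorphic to each other. -/
def UniqueUpToIso {V : Type*} (S : Set (SimpleGraph V)) : Prop :=
  ∀ G ∈ S, ∀ H ∈ S, Nonempty (G ≃g H)

/-!
On a bicyclic graph `∑_{uv ∈ E} (1 / d(u) + 1 / d(v)) = n`, since every vertex `v` contributes
`1 / d(v)` to each of its `d(v)` edges. The AM–HM inequality gives
`1 / √(x + y) ≤ 1 / 2 - (4 / 15) (1 - 1 / x - 1 / y)` for degrees `x, y ≥ 2`, and at an edge with a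
pendant end this still holds with the right-hand side lowered by `1 / 18`. Summing over the edges, a
bicyclic graph with a pendant vertex has index below the second largest value.

Without pendant vertices, `∑ (d(v) - 2) = 2` leaves two cases. Either one vertex has degree `4`, and
the index can be computed and is too small; or exactly two vertices have degree `3`, and then the
index depends only on whether they are adjacent, and is larger if they are. In the second case,
removing the edges of a shortest path between the two cubic vertices leaves every degree `0` or `2`,
hence disjoint cycles and isolated vertices, so the graph is one or two cycles joined by that path.
-/

open SimpleGraph

section OneDivSqrt

theorem one_div_sqrt_le {s t : ℝ} (ht : 0 < t) (hst : 1 ≤ s * t ^ 2) : 1 / √s ≤ t := by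
  have hs : 1 / t ^ 2 ≤ s := (div_le_iff₀ (by positivity)).2 hst
  rw [one_div_le (Real.sqrt_pos.2 (lt_of_lt_of_le (by positivity) hs)) ht]
  exact Real.le_sqrt_of_sq_le (by rwa [div_pow, one_pow])

theorem le_one_div_sqrt {s t : ℝ} (hs : 0 < s) (ht : 0 < t) (hst : s * t ^ 2 ≤ 1) :
    t ≤ 1 / √s := by
  rw [le_one_div ht (Real.sqrt_pos.2 hs), Real.sqrt_le_left (by positivity), div_pow, one_pow]
  exact (le_div_iff₀ (by positivity)).2 hst

end OneDivSqrt

section Index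

variable {V : Type*} [Fintype V] (G : SimpleGraph V)

open Classical in
theorem sum_darts_fst (h : V → ℝ) : ∑ d : G.Dart, h d.fst = ∑ v, G.degree v * h v := by
  rw [← Finset.sum_fiberwise' Finset.univ (fun d : G.Dart => d.fst) h]
  refine Finset.sum_congr rfl fun v _ => ?_
  rw [Finset.sum_const, G.dart_fst_fiber_card_eq_degree, nsmul_eq_mul]

open Classical in
theorem sum_darts_snd (h : V → ℝ) : ∑ d : G.Dart, h d.snd = ∑ v, G.degree v * h v := by
  rw [← sum_darts_fst]
  exact Fintype.sum_equiv (Function.Involutive.toPerm _ Dart.symm_involutive) _ _ fun _ => rfl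

open Classical in
theorem sum_darts_edge (f : Sym2 V → ℝ) :
    ∑ d : G.Dart, f d.edge = 2 * ∑ e ∈ G.edgeFinset, f e := by
  rw [← Finset.sum_fiberwise_of_maps_to' (t := G.edgeFinset) (g := Dart.edge)
    (fun d _ => mem_edgeFinset.2 d.edge_mem), Finset.mul_sum]
  refine Finset.sum_congr rfl fun e he => ?_
  rw [Finset.sum_const, G.dart_edge_fiber_card e (mem_edgeFinset.1 he), nsmul_eq_mul,
    Nat.cast_ofNat]

open Classical in
theorem sumConnectivityIndex_eq_sum_add (h : V → ℝ) :
    sumConnectivityIndex G = ∑ v, G.degree v * h v +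
      (∑ d : G.Dart, (1 / √((G.degree d.fst : ℝ) + G.degree d.snd) - (h d.fst + h d.snd))) / 2 := by
  have h2 : ∑ d : G.Dart, 1 / √((G.degree d.fst : ℝ) + G.degree d.snd) =
      2 * sumConnectivityIndex G :=
    sum_darts_edge G (Sym2.lift ⟨fun u v => 1 / √((G.degree u : ℝ) + G.degree v), _⟩)
  rw [Finset.sum_sub_distrib, Finset.sum_add_distrib, sum_darts_fst, sum_darts_snd, h2]
  ring

open Classical in
theorem sumConnectivityIndex_le_sum_degree_mul {h : V → ℝ}
    (hle : ∀ a b, G.Adj a b → 1 / √((G.degree a : ℝ) + G.degree b) ≤ h a + h b) :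
    sumConnectivityIndex G ≤ ∑ v, G.degree v * h v := by
  rw [sumConnectivityIndex_eq_sum_add G h]
  linarith [Finset.sum_nonpos fun (d : G.Dart) (_ : d ∈ Finset.univ) =>
    sub_nonpos.2 (hle d.fst d.snd d.adj)]

theorem sum_eq_card_mul_add_sum_sub {f : V → ℝ} {c : ℝ} {s : Finset V} (hf : ∀ w ∉ s, f w = c) :
    ∑ w, f w = Fintype.card V * c + ∑ w ∈ s, (f w - c) := by
  rw [Finset.sum_subset s.subset_univ fun w _ hw => sub_eq_zero.2 (hf w hw),
    Finset.sum_sub_distrib, Finset.sum_const, Finset.card_univ, nsmul_eq_mul]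
  ring

end Index

section PendantBound

/-- The share that an endpoint of degree `d` pays for an edge in the bound
`1 / √(x + y) ≤ edgeShare x + edgeShare y`. The bound is sharp for `x = y = 2`, and the slope
`4 / 15` in `1 / d` leaves room for the discount `1 / 18` at pendant vertices. -/
noncomputable def edgeShare (d : ℕ) : ℝ := 7 / 60 + 4 / 15 / d - if d = 1 then 1 / 18 else 0

theorem edgeShare_of_ne_one {d : ℕ} (hd : d ≠ 1) : edgeShare d = 7 / 60 + 4 / 15 / d := by
  rw [edgeShare, if_neg hd, sub_zero]

theorem edgeShare_one : edgeShare 1 = 59 / 180 := by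
  norm_num [edgeShare]

theorem natCast_mul_edgeShare_le (d : ℕ) :
    d * edgeShare d ≤ 7 / 60 * d + 4 / 15 - 1 / 18 * if d = 1 then 1 else 0 := by
  by_cases h1 : d = 1
  · subst h1
    rw [edgeShare_one]
    norm_num
  · rw [edgeShare_of_ne_one h1, if_neg h1]
    linear_combination 4 / 15 * mul_inv_le_one (a := (d : ℝ))

theorem one_div_sqrt_one_add_le_edgeShare {y : ℕ} (hy : 2 ≤ y) :
    1 / √(1 + (y : ℝ)) ≤ edgeShare 1 + edgeShare y := by
  rw [edgeShare_one, edgeShare_of_ne_one (by omega)]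
  obtain rfl | hy3 : y = 2 ∨ 3 ≤ y := by omega
  · exact one_div_sqrt_le (by norm_num) (by norm_num)
  have hy3' : (3 : ℝ) ≤ y := by exact_mod_cast hy3
  obtain hy5 | hy4 : 5 ≤ y ∨ y ≤ 4 := by omega
  · have hy5' : (5 : ℝ) ≤ y := by exact_mod_cast hy5
    have hsqrt : 1 / √(1 + (y : ℝ)) ≤ 4 / 9 := one_div_sqrt_le (by norm_num) (by linarith)
    have hshare : 0 ≤ 4 / 15 / (y : ℝ) := by positivity
    linarith
  · have hy4' : (y : ℝ) ≤ 4 := by exact_mod_cast hy4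
    have hsqrt : 1 / √(1 + (y : ℝ)) ≤ 1 / 2 := one_div_sqrt_le (by norm_num) (by linarith)
    have hshare : 4 / 15 / 4 ≤ 4 / 15 / (y : ℝ) := by gcongr
    linarith

theorem four_div_add_le_one_div_add_one_div {x y : ℝ} (hx : 0 < x) (hy : 0 < y) :
    4 / (x + y) ≤ 1 / x + 1 / y := by
  rw [div_add_div _ _ hx.ne' hy.ne', div_le_div_iff₀ (by positivity) (by positivity)]
  nlinarith [sq_nonneg (x - y)]

theorem one_div_sqrt_add_le_edgeShare {x y : ℕ} (hx : 2 ≤ x) (hy : 2 ≤ y) :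
    1 / √((x : ℝ) + y) ≤ edgeShare x + edgeShare y := by
  rw [edgeShare_of_ne_one (by omega), edgeShare_of_ne_one (by omega)]
  obtain ⟨rfl, rfl⟩ | ⟨rfl, rfl⟩ | ⟨rfl, rfl⟩ | hxy :
      (x = 2 ∧ y = 2) ∨ (x = 2 ∧ y = 3) ∨ (x = 3 ∧ y = 2) ∨ 6 ≤ x + y := by omega
  iterate 3 exact one_div_sqrt_le (by norm_num) (by norm_num)
  have hs : (6 : ℝ) ≤ x + y := by exact_mod_cast hxy
  set t := 1 / √((x : ℝ) + y) with ht_def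
  have ht : t ≤ 7 / 16 := one_div_sqrt_le (by norm_num) (by linarith)
  have hharmonic : 4 * t ^ 2 ≤ 1 / (x : ℝ) + 1 / y := by
    rw [ht_def, div_pow, one_pow, Real.sq_sqrt (by positivity), mul_one_div]
    exact four_div_add_le_one_div_add_one_div (by positivity) (by positivity)
  have hquadratic : 0 ≤ (1 / 2 - t) * (7 / 16 - t) := mul_nonneg (by linarith) (by linarith)
  rw [← mul_one_div _ (x : ℝ), ← mul_one_div _ (y : ℝ)]
  linarith

variable {V : Type*} [Fintype V] {G : SimpleGraph V}

open Classical in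
theorem one_div_sqrt_degree_add_le_edgeShare {a b : V} (hab : G.Adj a b)
    (hne : ¬ (G.degree a = 1 ∧ G.degree b = 1)) :
    1 / √((G.degree a : ℝ) + G.degree b) ≤ edgeShare (G.degree a) + edgeShare (G.degree b) := by
  have ha : 0 < G.degree a := (G.degree_pos_iff_exists_adj a).2 ⟨b, hab⟩
  have hb : 0 < G.degree b := (G.degree_pos_iff_exists_adj b).2 ⟨a, hab.symm⟩
  by_cases ha1 : G.degree a = 1
  · rw [ha1, Nat.cast_one]
    exact one_div_sqrt_one_add_le_edgeShare (by omega)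
  by_cases hb1 : G.degree b = 1
  · rw [hb1, Nat.cast_one, add_comm, add_comm (edgeShare _)]
    exact one_div_sqrt_one_add_le_edgeShare (by omega)
  exact one_div_sqrt_add_le_edgeShare (by omega) (by omega)

open Classical in
theorem sum_degrees_eq_two_mul_ncard_edgeSet : ∑ v, G.degree v = 2 * G.edgeSet.ncard := by
  rw [sum_degrees_eq_twice_card_edges, ← Set.ncard_coe_finset, coe_edgeFinset]

open Classical in
theorem sumConnectivityIndex_le_sub_card_pendant
    (hG : ∀ a b, G.Adj a b → ¬ (G.degree a = 1 ∧ G.degree b = 1)) :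
    sumConnectivityIndex G ≤ (G.edgeSet.ncard : ℝ) / 2 -
      4 / 15 * (G.edgeSet.ncard - Fintype.card V) -
      1 / 18 * (Finset.univ.filter fun v => G.degree v = 1).card := by
  have hdeg : ∑ v, (G.degree v : ℝ) = 2 * G.edgeSet.ncard := by
    exact_mod_cast sum_degrees_eq_two_mul_ncard_edgeSet
  calc sumConnectivityIndex G
      ≤ ∑ v, G.degree v * edgeShare (G.degree v) :=
        sumConnectivityIndex_le_sum_degree_mul G fun a b hab =>
          one_div_sqrt_degree_add_le_edgeShare hab (hG a b hab)
    _ ≤ ∑ v, (7 / 60 * (G.degree v : ℝ) + 4 / 15 - 1 / 18 * if G.degree v = 1 then 1 else 0) :=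
        Finset.sum_le_sum fun v _ => natCast_mul_edgeShare_le _
    _ = _ := by
        rw [Finset.sum_sub_distrib, Finset.sum_add_distrib, ← Finset.mul_sum, ← Finset.mul_sum,
          hdeg, Finset.sum_const, Finset.card_univ, nsmul_eq_mul, Finset.sum_boole]
        ring

end PendantBound

section Closed

variable {V : Type*} {G : SimpleGraph V}

theorem mem_of_forall_adj_mem (hG : G.Preconnected) {S : Set V} {a : V} (ha : a ∈ S)
    (hS : ∀ x ∈ S, ∀ y, G.Adj x y → y ∈ S) (b : V) : b ∈ S := by
  by_contra hb
  obtain ⟨p⟩ := hG a b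
  obtain ⟨d, -, hfst, hsnd⟩ := p.exists_boundary_dart S ha hb
  exact hsnd (hS _ hfst _ d.adj)

theorem not_degree_eq_one_and_degree_eq_one [Fintype V] [DecidableRel G.Adj]
    (hG : G.Preconnected) (hV : 3 ≤ Fintype.card V) {a b : V} (hab : G.Adj a b) :
    ¬ (G.degree a = 1 ∧ G.degree b = 1) := by
  classical
  rintro ⟨ha, hb⟩
  have ha' {y : V} (hy : G.Adj a y) : y = b :=
    (degree_eq_one_iff_existsUnique_adj.1 ha).unique hy hab
  have hb' {y : V} (hy : G.Adj b y) : y = a :=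
    (degree_eq_one_iff_existsUnique_adj.1 hb).unique hy hab.symm
  have hclosed : ∀ x ∈ ({a, b} : Set V), ∀ y, G.Adj x y → y ∈ ({a, b} : Set V) := by
    rintro x (rfl | rfl) y hxy
    · exact Or.inr (ha' hxy)
    · exact Or.inl (hb' hxy)
  have huniv : (Finset.univ : Finset V) ⊆ {a, b} := fun w _ => by
    simpa using mem_of_forall_adj_mem hG (Set.mem_insert a {b}) hclosed w
  have := (Finset.card_le_card huniv).trans Finset.card_le_two
  rw [Finset.card_univ] at this
  omega

end Closed

section EdgeExcess

/-- The deviation of `1 / √(x + y)` from the additive function of `x` and `y` with which it agrees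
whenever `x = 2` or `y = 2`. -/
noncomputable def edgeExcess (x y : ℕ) : ℝ :=
  1 / √((x : ℝ) + y) - ((1 / √((x : ℝ) + 2) - 1 / 4) + (1 / √((y : ℝ) + 2) - 1 / 4))

@[simp]
theorem edgeExcess_two_left (y : ℕ) : edgeExcess 2 y = 0 := by
  norm_num [edgeExcess, add_comm]

@[simp]
theorem edgeExcess_two_right (x : ℕ) : edgeExcess x 2 = 0 := by
  norm_num [edgeExcess]

theorem edgeExcess_three_three : edgeExcess 3 3 = 1 / √6 + 1 / 2 - 2 / √5 := by
  norm_num [edgeExcess]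
  ring

theorem edgeExcess_three_three_pos : 0 < edgeExcess 3 3 := by
  have hsqrt5 : 1 / √(5 : ℝ) ≤ 448 / 1000 := one_div_sqrt_le (by norm_num) (by norm_num)
  have hsqrt6 : 2 / 5 ≤ 1 / √(6 : ℝ) := le_one_div_sqrt (by norm_num) (by norm_num) (by norm_num)
  rw [edgeExcess_three_three, div_eq_mul_one_div 2]
  linarith

open Classical in
theorem sumConnectivityIndex_eq_sum_add_edgeExcess {V : Type*} [Fintype V] (G : SimpleGraph V) :
    sumConnectivityIndex G = ∑ v, G.degree v * (1 / √((G.degree v : ℝ) + 2) - 1 / 4) +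
      (∑ d : G.Dart, edgeExcess (G.degree d.fst) (G.degree d.snd)) / 2 :=
  sumConnectivityIndex_eq_sum_add G _

end EdgeExcess

section CubicPair

variable {V : Type*} [Fintype V] {G : SimpleGraph V} {u v : V}

open Classical in
/-- `G` is connected, `u` and `v` are two vertices of degree `3`, and every other vertex has
degree `2`: the degree condition that characterizes the families `B₁` and `B₃`. -/
structure IsCubicPair (G : SimpleGraph V) (u v : V) : Prop where
  connected : G.Connected
  ne : u ≠ v
  degree_eq (w : V) : G.degree w = if w = u ∨ w = v then 3 else 2

namespace IsCubicPair

theorem map_iso {W : Type*} [Fintype W] {H : SimpleGraph W} (h : IsCubicPair G u v) (f : G ≃g H) :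
    IsCubicPair H (f u) (f v) where
  connected := f.connected_iff.1 h.connected
  ne := f.injective.ne h.ne
  degree_eq w := by
    classical
    obtain ⟨w, rfl⟩ := f.surjective w
    rw [f.degree_eq, h.degree_eq, f.injective.eq_iff, f.injective.eq_iff]

open Classical in
theorem sum_comp_degree (h : IsCubicPair G u v) (f : ℕ → ℝ) :
    ∑ w, f (G.degree w) = Fintype.card V * f 2 + 2 * (f 3 - f 2) := by
  rw [sum_eq_card_mul_add_sum_sub (s := {u, v}) (c := f 2), Finset.sum_pair h.ne, h.degree_eq,
    h.degree_eq, if_pos (Or.inl rfl), if_pos (Or.inr rfl), two_mul]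
  intro w hw
  rw [h.degree_eq, if_neg (by simpa using hw)]

theorem ncard_edgeSet (h : IsCubicPair G u v) : G.edgeSet.ncard = Fintype.card V + 1 := by
  classical
  have hsum : (∑ w, (G.degree w : ℝ)) = 2 * G.edgeSet.ncard := by
    exact_mod_cast sum_degrees_eq_two_mul_ncard_edgeSet
  rw [h.sum_comp_degree fun d => (d : ℝ)] at hsum
  have : (G.edgeSet.ncard : ℝ) = Fintype.card V + 1 := by
    push_cast at hsum
    linarith
  exact_mod_cast this

open Classical in
theorem edge_eq_iff (h : IsCubicPair G u v) (d : G.Dart) :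
    d.edge = s(u, v) ↔ G.degree d.fst = 3 ∧ G.degree d.snd = 3 := by
  have hd := d.adj.ne
  simp only [h.degree_eq, ite_eq_left_iff, Nat.reduceEqDiff, imp_false, not_not]
  change s(d.fst, d.snd) = s(u, v) ↔ _
  rw [Sym2.eq_iff]
  grind

open Classical in
theorem degree_eq_two_or_three (h : IsCubicPair G u v) (w : V) :
    G.degree w = 2 ∨ G.degree w = 3 := by
  rw [h.degree_eq]
  split_ifs <;> simp

open Classical in
theorem sumConnectivityIndex_eq (h : IsCubicPair G u v) :
    sumConnectivityIndex G = ((Fintype.card V : ℝ) - 5) / 2 + 6 / √5 +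
      if G.Adj u v then edgeExcess 3 3 else 0 := by
  have hexcess (d : G.Dart) : edgeExcess (G.degree d.fst) (G.degree d.snd) =
      if d.edge = s(u, v) then edgeExcess 3 3 else 0 := by
    simp only [h.edge_eq_iff]
    obtain h1 | h1 := h.degree_eq_two_or_three d.fst <;>
    obtain h2 | h2 := h.degree_eq_two_or_three d.snd <;>
    simp [h1, h2]
  rw [sumConnectivityIndex_eq_sum_add_edgeExcess, Finset.sum_congr rfl fun d _ => hexcess d,
    sum_darts_edge G fun e => if e = s(u, v) then _ else _, Finset.sum_ite_eq',
    h.sum_comp_degree fun d => d * (1 / √(d + 2) - 1 / 4)]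
  rw [mul_div_cancel_left₀ _ two_ne_zero]
  simp only [mem_edgeFinset, mem_edgeSet]
  norm_num
  ring

end IsCubicPair

open Classical in
theorem sumConnectivityIndex_of_degree_eq_four {p : V} (hp : G.degree p = 4)
    (hw : ∀ w, w ≠ p → G.degree w = 2) :
    sumConnectivityIndex G = ((Fintype.card V : ℝ) - 3) / 2 + 4 / √6 := by
  have hexcess (d : G.Dart) : edgeExcess (G.degree d.fst) (G.degree d.snd) = 0 := by
    by_cases hfst : d.fst = p
    · rw [hw d.snd (hfst ▸ d.adj.ne'), edgeExcess_two_right]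
    · rw [hw d.fst hfst, edgeExcess_two_left]
  rw [sumConnectivityIndex_eq_sum_add_edgeExcess, Finset.sum_congr rfl fun d _ => hexcess d,
    Finset.sum_const_zero, sum_eq_card_mul_add_sum_sub (s := {p}) (c := 1 / 2),
    Finset.sum_singleton, hp]
  · norm_num
    ring
  · intro w hwp
    norm_num [hw w (by simpa using hwp)]

open Classical in
theorem exists_eq_ite_add_ite_of_sum_eq_two {f : V → ℕ} (hf : ∑ w, f w = 2) :
    ∃ u v, ∀ w, f w = (if w = u then 1 else 0) + if w = v then 1 else 0 := by
  obtain ⟨u, v, huv⟩ := Multiset.card_eq_two.1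
    (show (∑ w, Multiset.replicate (f w) w).card = 2 by simpa using hf)
  refine ⟨u, v, fun w => ?_⟩
  have := congrArg (Multiset.count w) huv
  simpa [Multiset.count_sum', Multiset.count_replicate, Multiset.count_singleton,
    ← Multiset.singleton_add] using this

open Classical in
theorem exists_isCubicPair_or_exists_degree_eq_four (hG : G.Connected)
    (hE : G.edgeSet.ncard = Fintype.card V + 1) (hdeg : ∀ w, 2 ≤ G.degree w) :
    (∃ u v, IsCubicPair G u v) ∨ ∃ p, G.degree p = 4 ∧ ∀ w, w ≠ p → G.degree w = 2 := by
  have hsum : ∑ w, (G.degree w - 2) = 2 := by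
    rw [Finset.sum_tsub_distrib _ fun w _ => hdeg w, sum_degrees_eq_two_mul_ncard_edgeSet, hE,
      Finset.sum_const, Finset.card_univ, smul_eq_mul]
    omega
  obtain ⟨u, v, hdeg_sub⟩ := exists_eq_ite_add_ite_of_sum_eq_two hsum
  have hdeg_eq (w : V) : G.degree w = 2 + ((if w = u then 1 else 0) + if w = v then 1 else 0) := by
    rw [← hdeg_sub, Nat.add_sub_cancel' (hdeg w)]
  obtain rfl | huv := eq_or_ne u v
  · exact Or.inr ⟨u, by simp [hdeg_eq], fun w hw => by simp [hdeg_eq, hw]⟩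
  · exact Or.inl ⟨u, v, hG, huv, fun w => by rw [hdeg_eq]; grind⟩

open Classical in
theorem sumConnectivityIndex_lt_of_degree_eq_one (hG : G.Connected)
    (hE : G.edgeSet.ncard = Fintype.card V + 1) (hV : 3 ≤ Fintype.card V) {p : V}
    (hp : G.degree p = 1) :
    sumConnectivityIndex G < ((Fintype.card V : ℝ) - 5) / 2 + 6 / √5 := by
  have hpendant : (1 : ℝ) ≤ (Finset.univ.filter fun v => G.degree v = 1).card := by
    exact_mod_cast Finset.card_pos.2 ⟨p, Finset.mem_filter.2 ⟨Finset.mem_univ p, hp⟩⟩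
  have hbound := sumConnectivityIndex_le_sub_card_pendant fun a b =>
    not_degree_eq_one_and_degree_eq_one hG.preconnected hV (a := a) (b := b)
  have hsqrt5 : 447 / 1000 ≤ 1 / √(5 : ℝ) :=
    le_one_div_sqrt (by norm_num) (by norm_num) (by norm_num)
  rw [hE] at hbound
  push_cast at hbound
  rw [div_eq_mul_one_div 6]
  linarith

theorem sumConnectivityIndex_lt_of_not_isCubicPair (hG : G.Connected)
    (hE : G.edgeSet.ncard = Fintype.card V + 1) (hV : 3 ≤ Fintype.card V)
    (hcubic : ¬ ∃ u v, IsCubicPair G u v) :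
    sumConnectivityIndex G < ((Fintype.card V : ℝ) - 5) / 2 + 6 / √5 := by
  classical
  by_cases hpendant : ∃ p, G.degree p = 1
  · obtain ⟨p, hp⟩ := hpendant
    exact sumConnectivityIndex_lt_of_degree_eq_one hG hE hV hp
  have : Nontrivial V := Fintype.one_lt_card_iff_nontrivial.1 (by omega)
  have hdeg (w : V) : 2 ≤ G.degree w := by
    have := hG.preconnected.degree_pos_of_nontrivial w
    have := not_exists.1 hpendant w
    omega
  obtain ⟨p, hp, hw⟩ :=
    (exists_isCubicPair_or_exists_degree_eq_four hG hE hdeg).resolve_left hcubic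
  have hsqrt5 : 447 / 1000 ≤ 1 / √(5 : ℝ) :=
    le_one_div_sqrt (by norm_num) (by norm_num) (by norm_num)
  have hsqrt6 : 1 / √(6 : ℝ) ≤ 41 / 100 := one_div_sqrt_le (by norm_num) (by norm_num)
  rw [sumConnectivityIndex_of_degree_eq_four hp hw, div_eq_mul_one_div 4, div_eq_mul_one_div 6]
  linarith

end CubicPair

section SupAndMap

variable {V W : Type*} {G H : SimpleGraph V}

theorem degree_sup_of_disjoint (h : Disjoint G H) (v : V) [Fintype (G.neighborSet v)]
    [Fintype (H.neighborSet v)] [Fintype ((G ⊔ H).neighborSet v)] :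
    (G ⊔ H).degree v = G.degree v + H.degree v := by
  rw [degree, neighborFinset_sup_of_disjoint v h, Finset.card_disjUnion, degree, degree]

theorem degree_map_apply {f : V → W} (hf : f.Injective) (v : V) [Fintype (G.neighborSet v)]
    [Fintype ((G.map f).neighborSet (f v))] : (G.map f).degree (f v) = G.degree v := by
  lift f to V ↪ W using hf
  simp only [← card_neighborSet_eq_degree, ← Nat.card_eq_fintype_card, neighborSet_map]
  exact Nat.card_image_of_injective f.injective _

theorem degree_map_of_notMem_range {f : V → W} {w : W} (hw : w ∉ Set.range f)
    [Fintype ((G.map f).neighborSet w)] : (G.map f).degree w = 0 := by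
  refine G.map f |>.degree_eq_zero w |>.mpr ?_
  rintro _ ⟨-, v, _, -, rfl, -⟩
  exact hw ⟨v, rfl⟩

end SupAndMap

section PathGraph

variable {V : Type*} {k : ℕ}

theorem eq_zero_or_eq_last_or_eq_castSucc_succ (i : Fin (k + 2)) :
    i = 0 ∨ i = Fin.last (k + 1) ∨ ∃ j : Fin k, i = j.castSucc.succ := by
  obtain rfl | ⟨i, rfl⟩ := i.eq_zero_or_eq_succ
  · exact Or.inl rfl
  · obtain ⟨j, rfl⟩ | rfl := i.eq_castSucc_or_eq_last
    · exact Or.inr (Or.inr ⟨j, rfl⟩)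
    · exact Or.inr (Or.inl rfl)

theorem degree_pathGraph (i : Fin (k + 2)) [Fintype ((pathGraph (k + 2)).neighborSet i)] :
    (pathGraph (k + 2)).degree i = if i = 0 ∨ i = Fin.last (k + 1) then 1 else 2 := by
  rw [← card_neighborSet_eq_degree, ← Nat.card_eq_fintype_card, Nat.card_coe_set_eq]
  rcases eq_zero_or_eq_last_or_eq_castSucc_succ i with rfl | rfl | ⟨j, rfl⟩
  · have hN : (pathGraph (k + 2)).neighborSet 0 = {Fin.succ 0} := by
      ext i
      simp only [mem_neighborSet, pathGraph_adj, Set.mem_singleton_iff, Fin.ext_iff]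
      grind
    rw [hN, Set.ncard_singleton, if_pos (Or.inl rfl)]
  · have hN : (pathGraph (k + 2)).neighborSet (Fin.last (k + 1)) = {(Fin.last k).castSucc} := by
      ext i
      simp only [mem_neighborSet, pathGraph_adj, Set.mem_singleton_iff, Fin.ext_iff]
      grind
    rw [hN, Set.ncard_singleton, if_pos (Or.inr rfl)]
  · have hN : (pathGraph (k + 2)).neighborSet j.castSucc.succ =
        {j.castSucc.castSucc, j.succ.succ} := by
      ext i
      simp only [mem_neighborSet, pathGraph_adj, Set.mem_insert_iff, Set.mem_singleton_iff,
        Fin.ext_iff]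
      grind
    rw [hN, Set.ncard_pair (by grind), if_neg (by grind)]

open Classical in
theorem degree_map_pathGraph {f : Fin (k + 2) → V} (hf : f.Injective) (v : V)
    [Fintype (((pathGraph (k + 2)).map f).neighborSet v)] :
    ((pathGraph (k + 2)).map f).degree v =
      if v = f 0 ∨ v = f (Fin.last (k + 1)) then 1 else if v ∈ Set.range f then 2 else 0 := by
  by_cases hv : v ∈ Set.range f
  · obtain ⟨i, rfl⟩ := hv
    simp only [degree_map_apply hf, degree_pathGraph, hf.eq_iff, Set.mem_range_self, if_true]
  · have hne (i) : v ≠ f i := fun h => hv ⟨i, h.symm⟩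
    simp only [degree_map_of_notMem_range hv, hne, hv, or_self, if_false]

end PathGraph

section JoinByPath

variable {W : Type*} {G : SimpleGraph W} {x y : W} {k : ℕ}

theorem pathVertices_zero : pathVertices x y k 0 = Sum.inl x := rfl

theorem pathVertices_last : pathVertices x y k (Fin.last (k + 1)) = Sum.inl y := by
  rw [← Fin.succ_last, pathVertices, Fin.cons_succ, Fin.snoc_last]

theorem pathVertices_castSucc_succ (j : Fin k) :
    pathVertices x y k j.castSucc.succ = Sum.inr j := by
  rw [pathVertices, Fin.cons_succ, Fin.snoc_castSucc]

theorem pathVertices_eq_inl_iff {i : Fin (k + 2)} {w : W} :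
    pathVertices x y k i = Sum.inl w ↔ i = 0 ∧ x = w ∨ i = Fin.last (k + 1) ∧ y = w := by
  rcases eq_zero_or_eq_last_or_eq_castSucc_succ i with rfl | rfl | ⟨j, rfl⟩
  · simp [pathVertices_zero, Fin.ext_iff]
  · simp [pathVertices_last, Fin.ext_iff]
  · simp [pathVertices_castSucc_succ, Fin.ext_iff, j.isLt.ne]

theorem pathVertices_injective (hxy : x ≠ y) : (pathVertices x y k).Injective := by
  intro i i' h
  rcases eq_zero_or_eq_last_or_eq_castSucc_succ i with rfl | rfl | ⟨j, rfl⟩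
  · rw [pathVertices_zero, eq_comm, pathVertices_eq_inl_iff] at h
    exact (h.resolve_right fun h => hxy h.2.symm).1.symm
  · rw [pathVertices_last, eq_comm, pathVertices_eq_inl_iff] at h
    exact (h.resolve_left fun h => hxy h.2).1.symm
  · rcases eq_zero_or_eq_last_or_eq_castSucc_succ i' with rfl | rfl | ⟨j', rfl⟩ <;>
    simp only [pathVertices_zero, pathVertices_last, pathVertices_castSucc_succ, Sum.inr.injEq,
      reduceCtorEq] at h
    rw [h]

theorem joinByPath_eq_sup :
    joinByPath G x y k = G.map Function.Embedding.inl ⊔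
      (pathGraph (k + 2)).map (pathVertices x y k) := by
  rw [joinByPath]
  congr 1
  ext a b
  rw [fromEdgeSet_adj, map_adj', and_comm, and_congr_right_iff]
  refine fun _ => ⟨?_, ?_⟩
  · rintro ⟨i, hi⟩
    have hadj : (pathGraph (k + 2)).Adj i.castSucc i.succ := by simp [pathGraph_adj]
    rcases Sym2.eq_iff.mp hi with ⟨rfl, rfl⟩ | ⟨rfl, rfl⟩
    · exact ⟨_, _, hadj, rfl, rfl⟩
    · exact ⟨_, _, hadj.symm, rfl, rfl⟩
  · rintro ⟨i, j, hij, rfl, rfl⟩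
    rcases pathGraph_adj.mp hij with h | h
    · exact ⟨⟨i, by omega⟩, congrArg₂ (fun a b => s(pathVertices x y k a, pathVertices x y k b))
        rfl (Fin.ext h.symm)⟩
    · exact ⟨⟨j, by omega⟩, Sym2.eq_swap.trans <|
        congrArg₂ (fun a b => s(pathVertices x y k a, pathVertices x y k b)) rfl (Fin.ext h.symm)⟩

theorem joinByPath_adj_inl {a b : W} (h : G.Adj a b) :
    (joinByPath G x y k).Adj (Sum.inl a) (Sum.inl b) := by
  rw [joinByPath_eq_sup, sup_adj]
  exact Or.inl (map_adj_apply.mpr h)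

theorem joinByPath_adj_pathVertices (hxy : x ≠ y) {i j : Fin (k + 2)}
    (hij : (pathGraph (k + 2)).Adj i j) :
    (joinByPath G x y k).Adj (pathVertices x y k i) (pathVertices x y k j) := by
  rw [joinByPath_eq_sup, sup_adj]
  exact Or.inr (map_adj_apply' hij ((pathVertices_injective hxy).ne hij.ne))

theorem disjoint_map_inl_map_pathVertices (hadj : ¬ G.Adj x y) :
    Disjoint (G.map Function.Embedding.inl) ((pathGraph (k + 2)).map (pathVertices x y k)) := by
  rw [disjoint_left]
  rintro _ _ ⟨-, a, b, hab, rfl, rfl⟩ ⟨-, i, j, hij, hi, hj⟩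
  rcases pathVertices_eq_inl_iff.mp hi with ⟨rfl, rfl⟩ | ⟨rfl, rfl⟩ <;>
  rcases pathVertices_eq_inl_iff.mp hj with ⟨rfl, rfl⟩ | ⟨rfl, rfl⟩
  exacts [hij.ne rfl, hadj hab, hadj hab.symm, hij.ne rfl]

theorem joinByPath_adj_inl_inl_iff (hxy : x ≠ y) (hadj : ¬ G.Adj x y) :
    (joinByPath G x y k).Adj (Sum.inl x) (Sum.inl y) ↔ k = 0 := by
  have hpath : (pathGraph (k + 2)).Adj 0 (Fin.last (k + 1)) ↔ k = 0 := by
    simp [pathGraph_adj, eq_comm]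
  refine ⟨fun h => ?_, fun hk => ?_⟩
  · rw [joinByPath_eq_sup, sup_adj] at h
    obtain ⟨-, i, j, hij, hi, hj⟩ := h.resolve_left fun h => hadj (map_adj_apply.mp h)
    obtain rfl := ((pathVertices_eq_inl_iff.mp hi).resolve_right fun h => hxy h.2.symm).1
    obtain rfl := ((pathVertices_eq_inl_iff.mp hj).resolve_left fun h => hxy h.2).1
    exact hpath.mp hij
  · simpa only [pathVertices_zero, pathVertices_last] using
      joinByPath_adj_pathVertices (G := G) hxy (hpath.mpr hk)

theorem joinByPath_connected (hxy : x ≠ y) (hG : ∀ w, G.Reachable x w ∨ G.Reachable y w) :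
    (joinByPath G x y k).Connected := by
  have reachable_pathVertices (i) :
      (joinByPath G x y k).Reachable (Sum.inl x) (pathVertices x y k i) :=
    (pathGraph_preconnected _ 0 i).map
      (⟨pathVertices x y k, joinByPath_adj_pathVertices hxy⟩ : _ →g joinByPath G x y k)
  have reachable_inl {a b} (h : G.Reachable a b) :
      (joinByPath G x y k).Reachable (Sum.inl a) (Sum.inl b) :=
    h.map (⟨Sum.inl, joinByPath_adj_inl⟩ : G →g joinByPath G x y k)
  refine connected_iff_exists_forall_reachable _ |>.mpr ⟨Sum.inl x, ?_⟩
  rintro (w | j)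
  · rcases hG w with h | h
    · exact reachable_inl h
    · exact (pathVertices_last (x := x) ▸ reachable_pathVertices (Fin.last _)).trans
        (reachable_inl h)
  · exact pathVertices_castSucc_succ (x := x) j ▸ reachable_pathVertices j.castSucc.succ

open Classical in
theorem isCubicPair_joinByPath [Fintype W] (hxy : x ≠ y) (hadj : ¬ G.Adj x y)
    (hdeg : ∀ w, G.degree w = 2) (hG : ∀ w, G.Reachable x w ∨ G.Reachable y w) :
    IsCubicPair (joinByPath G x y k) (Sum.inl x) (Sum.inl y) := by
  refine ⟨joinByPath_connected hxy hG, Sum.inl_injective.ne hxy, fun w => ?_⟩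
  have degree_eq_add : (joinByPath G x y k).degree w = (G.map Function.Embedding.inl).degree w +
      ((pathGraph (k + 2)).map (pathVertices x y k)).degree w := by
    rw [← degree_sup_of_disjoint (disjoint_map_inl_map_pathVertices hadj)]
    congr!
    exact joinByPath_eq_sup
  rw [degree_eq_add, degree_map_pathGraph (pathVertices_injective hxy), pathVertices_zero,
    pathVertices_last]
  rcases w with w | j
  · have hmem : Sum.inl w ∈ Set.range (pathVertices x y k) → w = x ∨ w = y := by
      rintro ⟨i, hi⟩
      exact (pathVertices_eq_inl_iff.mp hi).imp (·.2.symm) (·.2.symm)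
    have hmap := degree_map_apply (G := G) (Function.Embedding.inl (β := Fin k)).injective w
    rw [Function.Embedding.inl_apply, hdeg] at hmap
    by_cases hw : w = x ∨ w = y
    · simp [hmap, hw]
    · simp [hmap, hw, mt hmem hw]
  · have hmem : Sum.inr j ∈ Set.range (pathVertices x y k) := ⟨_, pathVertices_castSucc_succ j⟩
    rw [degree_map_of_notMem_range (by simp)]
    simp [hmem]

end JoinByPath

section JoinByPathIso

variable {W : Type*}

theorem nonempty_iso_joinByPath_zero (G : SimpleGraph W) (x y : W) :
    Nonempty (G ⊔ edge x y ≃g joinByPath G x y 0) := by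
  refine ⟨⟨(Equiv.sumEmpty W (Fin 0)).symm, fun {a b} => ?_⟩⟩
  have hends : pathVertices x y 0 1 = Sum.inl y := pathVertices_last
  simp [joinByPath, edge, hends, pathVertices_zero]

theorem nonempty_iso_joinByPath {W' : Type*} {G : SimpleGraph W} {G' : SimpleGraph W'}
    (e : G ≃g G') (x y : W) (k : ℕ) :
    Nonempty (joinByPath G x y k ≃g joinByPath G' (e x) (e y) k) := by
  let φ : W ⊕ Fin k ≃ W' ⊕ Fin k := e.toEquiv.sumCongr (Equiv.refl _)
  have map_pathVertices (i) : pathVertices (e x) (e y) k i = φ (pathVertices x y k i) := by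
    rcases eq_zero_or_eq_last_or_eq_castSucc_succ i with rfl | rfl | ⟨j, rfl⟩
    · rfl
    · rw [pathVertices_last, pathVertices_last]; rfl
    · rw [pathVertices_castSucc_succ, pathVertices_castSucc_succ]; rfl
  refine ⟨⟨φ, fun {a b} => ?_⟩⟩
  simp only [joinByPath_eq_sup, sup_adj, map_adj', map_pathVertices, φ.injective.eq_iff,
    φ.injective.ne_iff]
  rcases a with a | a <;> rcases b with b | b <;> simp [φ, e.map_rel_iff]

end JoinByPathIso

section Covering

variable {V W : Type*} {F : SimpleGraph W} {G : SimpleGraph V}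

theorem nonempty_iso_of_degree_le [Nonempty W] [F.LocallyFinite] [G.LocallyFinite]
    (hG : G.Preconnected) (f : Copy F G) (hf : ∀ w, G.degree (f w) ≤ F.degree w) :
    Nonempty (F ≃g G) := by
  have injective : Function.Injective f := f.injective
  have image_neighborSet (w) : f '' F.neighborSet w = G.neighborSet (f w) := by
    refine Set.eq_of_subset_of_ncard_le ?_ ?_ (Set.toFinite _)
    · rintro _ ⟨z, hz, rfl⟩
      exact f.toHom.map_adj hz
    · rw [Set.ncard_image_of_injective _ injective, Set.ncard_eq_toFinset_card',
        Set.ncard_eq_toFinset_card']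
      exact hf w
  have exists_of_adj {w v} (h : G.Adj (f w) v) : ∃ z, F.Adj w z ∧ f z = v := by
    rwa [← mem_neighborSet, ← image_neighborSet] at h
  have surjective : Function.Surjective f := by
    refine mem_of_forall_adj_mem hG (a := f (Classical.arbitrary W)) ⟨_, rfl⟩ ?_
    rintro _ ⟨w, rfl⟩ v hv
    obtain ⟨z, -, rfl⟩ := exists_of_adj hv
    exact ⟨z, rfl⟩
  refine ⟨⟨Equiv.ofBijective f ⟨injective, surjective⟩, fun {a b} => ⟨fun h => ?_, ?_⟩⟩⟩
  · obtain ⟨z, hz, hzb⟩ := exists_of_adj h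
    exact injective hzb ▸ hz
  · exact f.toHom.map_adj

theorem IsCubicPair.nonempty_iso_of_copy [Fintype V] [Fintype W] {x y : W} {u v : V}
    (hF : IsCubicPair F x y) (hG : IsCubicPair G u v) (f : Copy F G) (hx : f x = u) (hy : f y = v) :
    Nonempty (F ≃g G) := by
  classical
  have : Nonempty W := ⟨x⟩
  refine nonempty_iso_of_degree_le hG.connected.preconnected f fun w => le_of_eq ?_
  subst hx hy
  convert (hG.degree_eq (f w)).trans ?_
  have injective : Function.Injective f := f.injective
  simp only [hF.degree_eq, injective.eq_iff]

theorem exists_copy_joinByPath {x y : W} {k : ℕ} (f : Copy F G) (p : Copy (pathGraph (k + 2)) G)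
    (hx : f x = p 0) (hy : f y = p (Fin.last (k + 1)))
    (hfp : ∀ w (j : Fin k), f w ≠ p j.castSucc.succ) :
    ∃ g : Copy (joinByPath F x y k) G, ∀ w, g (Sum.inl w) = f w := by
  let φ : W ⊕ Fin k → V := Sum.elim f fun j => p j.castSucc.succ
  have φ_pathVertices (i) : φ (pathVertices x y k i) = p i := by
    rcases eq_zero_or_eq_last_or_eq_castSucc_succ i with rfl | rfl | ⟨j, rfl⟩
    · rw [pathVertices_zero, ← hx]; rfl
    · rw [pathVertices_last, ← hy]; rfl
    · rw [pathVertices_castSucc_succ]; rfl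
  have φ_injective : φ.Injective := f.injective.sumElim
    (p.injective.comp ((Fin.succ_injective _).comp (Fin.castSucc_injective _))) hfp
  refine ⟨⟨⟨φ, ?_⟩, φ_injective⟩, fun _ => rfl⟩
  intro a b hab
  rw [joinByPath_eq_sup, sup_adj] at hab
  rcases hab with ⟨-, a, b, hab, rfl, rfl⟩ | ⟨-, i, j, hij, rfl, rfl⟩
  · exact f.toHom.map_adj hab
  · rw [φ_pathVertices, φ_pathVertices]
    exact p.toHom.map_adj hij

end Covering

section Families

theorem degree_cycleGraph {a : ℕ} (ha : 3 ≤ a) (v : Fin a)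
    [Fintype ((cycleGraph a).neighborSet v)] :
    (cycleGraph a).degree v = 2 := by
  obtain ⟨m, rfl⟩ := Nat.exists_eq_add_of_le' ha
  rw [← cycleGraph_degree_three_le (v := v)]
  convert rfl

theorem degree_sum_inl {V W : Type*} {G : SimpleGraph V} {H : SimpleGraph W} (v : V)
    [Fintype (G.neighborSet v)] [Fintype ((G ⊕g H).neighborSet (Sum.inl v))] :
    (G ⊕g H).degree (Sum.inl v) = G.degree v := by
  simp only [← card_neighborSet_eq_degree, ← Nat.card_eq_fintype_card, neighborSet_sum_inl]
  exact Nat.card_image_of_injective Sum.inl_injective _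

theorem degree_sum_inr {V W : Type*} {G : SimpleGraph V} {H : SimpleGraph W} (w : W)
    [Fintype (H.neighborSet w)] [Fintype ((G ⊕g H).neighborSet (Sum.inr w))] :
    (G ⊕g H).degree (Sum.inr w) = H.degree w := by
  simp only [← card_neighborSet_eq_degree, ← Nat.card_eq_fintype_card, neighborSet_sum_inr]
  exact Nat.card_image_of_injective Sum.inr_injective _

theorem isCubicPair_joinByPath_cycleGraph {a : ℕ} (ha : 3 ≤ a) {x y : Fin a} (hxy : x ≠ y)
    (hadj : ¬ (cycleGraph a).Adj x y) (k : ℕ) :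
    IsCubicPair (joinByPath (cycleGraph a) x y k) (Sum.inl x) (Sum.inl y) :=
  isCubicPair_joinByPath hxy hadj (fun w => by rw [degree_cycleGraph ha])
    fun w => Or.inl (cycleGraph_preconnected x w)

theorem isCubicPair_joinByPath_cycleGraph_sum {a b : ℕ} (ha : 3 ≤ a) (hb : 3 ≤ b) (u : Fin a)
    (v : Fin b) (k : ℕ) :
    IsCubicPair (joinByPath (cycleGraph a ⊕g cycleGraph b) (Sum.inl u) (Sum.inr v) k)
      (Sum.inl (Sum.inl u)) (Sum.inl (Sum.inr v)) := by
  classical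
  refine isCubicPair_joinByPath Sum.inl_ne_inr (not_adj_sum_inl_inr u v) ?_ ?_
  · rintro (w | w)
    · rw [degree_sum_inl, degree_cycleGraph ha]
    · rw [degree_sum_inr, degree_cycleGraph hb]
  · rintro (w | w)
    · exact Or.inl ((cycleGraph_preconnected u w).map Embedding.sumInl.toHom)
    · exact Or.inr ((cycleGraph_preconnected v w).map Embedding.sumInr.toHom)

end Families

section CyclesAndGeodesics

variable {V : Type*} {G H : SimpleGraph V}

theorem exists_nonempty_iso_cycleGraph [Finite V] [G.LocallyFinite] (hG : G.Connected)
    (hdeg : ∀ v, G.degree v = 2) : ∃ a, 3 ≤ a ∧ Nonempty (cycleGraph a ≃g G) := by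
  have isCycles : G.IsCycles := fun v _ => by
    rw [Set.ncard_eq_toFinset_card', ← hdeg v]; rfl
  have ⟨v⟩ := hG.nonempty
  have hv : (G.neighborSet v).Nonempty := by
    rw [← G.degree_pos_iff_nonempty, hdeg]; exact two_pos
  obtain ⟨p, hp, -⟩ := isCycles.exists_cycle_toSubgraph_verts_eq_connectedComponentSupp
    (c := G.connectedComponentMk v) rfl hv
  have hlength := hp.three_le_length
  obtain ⟨f⟩ := (cycleGraph_isContained_iff hlength).mpr ⟨v, p, hp, rfl⟩
  have : Nonempty (Fin p.length) := ⟨⟨0, by omega⟩⟩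
  classical
  exact ⟨p.length, hlength, nonempty_iso_of_degree_le hG.preconnected f fun w => by
    rw [hdeg, degree_cycleGraph hlength]⟩

theorem exists_copy_cycleGraph_range_iff_reachable [Fintype V] [DecidableRel H.Adj] {u : V}
    (hdeg : ∀ w, H.degree w = 0 ∨ H.degree w = 2) (hu : H.degree u ≠ 0) :
    ∃ a, 3 ≤ a ∧ ∃ f : Copy (cycleGraph a) H, ∀ w, w ∈ Set.range f ↔ H.Reachable u w := by
  classical
  let C : H.ConnectedComponent := H.connectedComponentMk u
  have mem_supp_iff (w) : w ∈ C.supp ↔ H.Reachable u w :=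
    ConnectedComponent.eq.trans reachable_comm
  have degree_eq_two (w) : (H.induce C.supp).degree w = 2 := by
    rw [degree_induce_of_neighborSet_subset fun z hz => C.mem_supp_of_adj_mem_supp w.2 hz]
    refine (hdeg w).resolve_left ?_
    obtain heq | hne := eq_or_ne u w
    · rwa [← heq]
    · exact (((mem_supp_iff w).mp w.2).degree_pos_right hne).ne'
  obtain ⟨a, ha, ⟨e⟩⟩ := exists_nonempty_iso_cycleGraph (G := H.induce C.supp)
    C.connected_toSimpleGraph degree_eq_two
  refine ⟨a, ha, (Embedding.induce C.supp).toCopy.comp e.toCopy, fun w => ?_⟩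
  rw [← mem_supp_iff]
  refine ⟨?_, fun hw => ⟨e.symm ⟨w, hw⟩, ?_⟩⟩
  · rintro ⟨i, rfl⟩
    exact (e i).2
  · exact congrArg Subtype.val (e.apply_symm_apply ⟨w, hw⟩)

theorem exists_copy_pathGraph {u v : V} {p : G.Walk u v} (hp : p.IsPath) {k : ℕ}
    (hk : p.length = k) : ∃ f : Copy (pathGraph (k + 1)) G, f 0 = u ∧ f (Fin.last k) = v := by
  classical
  subst hk
  have copy_apply (i : Fin (p.length + 1)) : hp.pathGraphCopy i = p.getVert i :=
    p.support_getElem_eq_getVert (p.length_support.symm ▸ i.isLt)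
  refine ⟨hp.pathGraphCopy, ?_, ?_⟩
  · rw [copy_apply, Fin.val_zero, p.getVert_zero]
  · rw [copy_apply, Fin.val_last, p.getVert_length]

theorem exists_copy_pathGraph_of_reachable {u v : V} (huv : G.Reachable u v) (hne : u ≠ v) :
    ∃ k, (G.Adj u v ↔ k = 0) ∧ ∃ p : Copy (pathGraph (k + 2)) G,
      p 0 = u ∧ p (Fin.last (k + 1)) = v := by
  obtain ⟨p, hp, hlength⟩ := huv.exists_path_of_dist
  have dist_pos := huv.pos_dist_of_ne hne
  obtain ⟨k, hk⟩ : ∃ k, p.length = k + 1 := ⟨p.length - 1, by omega⟩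
  refine ⟨k, ?_, exists_copy_pathGraph hp hk⟩
  rw [← dist_eq_one_iff_adj, ← hlength, hk, Nat.add_eq_right]

end CyclesAndGeodesics

namespace IsCubicPair

variable {V : Type*} [Fintype V] {G : SimpleGraph V} {u v : V} {k : ℕ}
  {p : Copy (pathGraph (k + 2)) G}

open Classical in
theorem degree_sdiff_map_pathGraph (hG : IsCubicPair G u v) (hu : p 0 = u)
    (hv : p (Fin.last (k + 1)) = v) (w : V) :
    (G \ (pathGraph (k + 2)).map p).degree w =
      if w ∈ Set.range fun j : Fin k => p j.castSucc.succ then 0 else 2 := by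
  have injective : Function.Injective p := p.injective
  have degree_add : (G \ (pathGraph (k + 2)).map p).degree w +
      ((pathGraph (k + 2)).map p).degree w = G.degree w := by
    rw [← degree_sup_of_disjoint disjoint_sdiff_self_left]
    congr!
    refine sdiff_sup_cancel ?_
    rintro _ _ ⟨-, i, j, hij, rfl, rfl⟩
    exact p.toHom.map_adj hij
  rw [degree_map_pathGraph injective, hG.degree_eq, hu, hv] at degree_add
  have mem_range_iff : w ∈ Set.range p ↔
      w = u ∨ w = v ∨ w ∈ Set.range fun j : Fin k => p j.castSucc.succ := by
    constructor
    · rintro ⟨i, rfl⟩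
      rcases eq_zero_or_eq_last_or_eq_castSucc_succ i with rfl | rfl | ⟨j, rfl⟩
      exacts [Or.inl hu, Or.inr (Or.inl hv), Or.inr (Or.inr ⟨j, rfl⟩)]
    · rintro (rfl | rfl | ⟨j, rfl⟩)
      exacts [⟨_, hu⟩, ⟨_, hv⟩, ⟨_, rfl⟩]
  have interior_ne (hw : w ∈ Set.range fun j : Fin k => p j.castSucc.succ) :
      ¬ (w = u ∨ w = v) := by
    obtain ⟨j, rfl⟩ := hw
    rw [← hu, ← hv, injective.eq_iff, injective.eq_iff, Fin.ext_iff, Fin.ext_iff]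
    simp [j.isLt.ne]
  grind

theorem copy_cycleGraph_ne_interior (hG : IsCubicPair G u v) (hu : p 0 = u)
    (hv : p (Fin.last (k + 1)) = v) {a : ℕ} (ha : 3 ≤ a)
    (f : Copy (cycleGraph a) (G \ (pathGraph (k + 2)).map p)) (i : Fin a) (j : Fin k) :
    f i ≠ p j.castSucc.succ := by
  classical
  intro h
  have hdegree := f.degree_le i
  rw [degree_cycleGraph ha, hG.degree_sdiff_map_pathGraph hu hv, if_pos ⟨j, h.symm⟩] at hdegree
  exact absurd hdegree (by decide)

theorem exists_copy_cycleGraph_sdiff (hG : IsCubicPair G u v) (hu : p 0 = u)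
    (hv : p (Fin.last (k + 1)) = v) {x : V} (hx : x = u ∨ x = v) :
    ∃ a, 3 ≤ a ∧ ∃ f : Copy (cycleGraph a) (G \ (pathGraph (k + 2)).map p),
      ∀ w, w ∈ Set.range f ↔ (G \ (pathGraph (k + 2)).map p).Reachable x w := by
  classical
  have injective : Function.Injective p := p.injective
  refine exists_copy_cycleGraph_range_iff_reachable (fun w => ?_) ?_
  · rw [hG.degree_sdiff_map_pathGraph hu hv]
    exact ite_eq_or_eq _ _ _
  · rw [hG.degree_sdiff_map_pathGraph hu hv, if_neg]
    · decide
    rintro ⟨j, rfl⟩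
    simp [← hu, ← hv, injective.eq_iff, Fin.ext_iff, j.isLt.ne] at hx

theorem exists_iso_joinByPath_cycleGraph (hG : IsCubicPair G u v) (hadj : G.Adj u v → k = 0)
    (hu : p 0 = u) (hv : p (Fin.last (k + 1)) = v)
    (huv : (G \ (pathGraph (k + 2)).map p).Reachable u v) :
    ∃ a, 3 ≤ a ∧ ∃ x y : Fin a, x ≠ y ∧ ¬ (cycleGraph a).Adj x y ∧
      Nonempty (G ≃g joinByPath (cycleGraph a) x y k) := by
  obtain ⟨a, ha, f, range_iff⟩ := hG.exists_copy_cycleGraph_sdiff hu hv (Or.inl rfl)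
  obtain ⟨x, hx⟩ := (range_iff u).mpr (Reachable.refl u)
  obtain ⟨y, hy⟩ := (range_iff v).mpr huv
  have hxy : x ≠ y := by
    rintro rfl
    exact hG.ne (hx.symm.trans hy)
  have not_adj : ¬ (cycleGraph a).Adj x y := by
    intro h
    have h : (G \ (pathGraph (k + 2)).map p).Adj u v := hx ▸ hy ▸ f.toHom.map_adj h
    rw [sdiff_adj] at h
    obtain rfl := hadj h.1
    exact h.2 ⟨hG.ne, 0, Fin.last 1, by simp [pathGraph_adj], hu, hv⟩
  obtain ⟨g, hg⟩ := exists_copy_joinByPath ((Copy.ofLE _ _ sdiff_le).comp f) p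
    (hx.trans hu.symm) (hy.trans hv.symm) (hG.copy_cycleGraph_ne_interior hu hv ha f)
  obtain ⟨e⟩ := (isCubicPair_joinByPath_cycleGraph ha hxy not_adj k).nonempty_iso_of_copy hG g
    ((hg x).trans hx) ((hg y).trans hy)
  exact ⟨a, ha, x, y, hxy, not_adj, ⟨e.symm⟩⟩

theorem exists_iso_joinByPath_cycleGraph_sum (hG : IsCubicPair G u v)
    (hu : p 0 = u) (hv : p (Fin.last (k + 1)) = v)
    (huv : ¬ (G \ (pathGraph (k + 2)).map p).Reachable u v) :
    ∃ a b, 3 ≤ a ∧ 3 ≤ b ∧ ∃ (x : Fin a) (y : Fin b), Nonempty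
      (G ≃g joinByPath (cycleGraph a ⊕g cycleGraph b) (Sum.inl x) (Sum.inr y) k) := by
  obtain ⟨a, ha, f, range_f_iff⟩ := hG.exists_copy_cycleGraph_sdiff hu hv (Or.inl rfl)
  obtain ⟨b, hb, g, range_g_iff⟩ := hG.exists_copy_cycleGraph_sdiff hu hv (Or.inr rfl)
  obtain ⟨x, hx⟩ := (range_f_iff u).mpr (Reachable.refl u)
  obtain ⟨y, hy⟩ := (range_g_iff v).mpr (Reachable.refl v)
  have disjoint_ranges (i j) : f i ≠ g j := fun h => huv <|
    ((range_f_iff _).mp ⟨i, h⟩).trans ((range_g_iff _).mp ⟨j, rfl⟩).symm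
  let fg : Copy (cycleGraph a ⊕g cycleGraph b) G :=
    ⟨⟨Sum.elim f g, by
      rintro (i | i) (j | j) hij
      · exact (f.toHom.map_adj (hij)).1
      · exact absurd hij (not_adj_sum_inl_inr _ _)
      · exact absurd hij.symm (not_adj_sum_inl_inr _ _)
      · exact (g.toHom.map_adj (hij)).1⟩,
    f.injective.sumElim g.injective disjoint_ranges⟩
  obtain ⟨h, hh⟩ := exists_copy_joinByPath fg p (x := Sum.inl x) (y := Sum.inr y)
    (hx.trans hu.symm) (hy.trans hv.symm) (Sum.rec
      (hG.copy_cycleGraph_ne_interior hu hv ha f) (hG.copy_cycleGraph_ne_interior hu hv hb g))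
  obtain ⟨e⟩ := (isCubicPair_joinByPath_cycleGraph_sum ha hb x y k).nonempty_iso_of_copy hG h
    ((hh _).trans hx) ((hh _).trans hy)
  exact ⟨a, b, ha, hb, x, y, ⟨e.symm⟩⟩

theorem exists_iso_joinByPath (hG : IsCubicPair G u v) : ∃ k, (G.Adj u v ↔ k = 0) ∧
    ((∃ a b, 3 ≤ a ∧ 3 ≤ b ∧ a + b + k = Fintype.card V ∧ ∃ (x : Fin a) (y : Fin b), Nonempty
      (G ≃g joinByPath (cycleGraph a ⊕g cycleGraph b) (Sum.inl x) (Sum.inr y) k)) ∨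
    ∃ a, 4 ≤ a ∧ a + k = Fintype.card V ∧ ∃ x y : Fin a, x ≠ y ∧ ¬ (cycleGraph a).Adj x y ∧
      Nonempty (G ≃g joinByPath (cycleGraph a) x y k)) := by
  obtain ⟨k, hadj, p, hu, hv⟩ := exists_copy_pathGraph_of_reachable (hG.connected u v) hG.ne
  refine ⟨k, hadj, ?_⟩
  by_cases huv : (G \ (pathGraph (k + 2)).map p).Reachable u v
  · obtain ⟨a, ha, x, y, hxy, not_adj, ⟨e⟩⟩ :=
      hG.exists_iso_joinByPath_cycleGraph hadj.mp hu hv huv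
    refine Or.inr ⟨a, ha.lt_of_ne ?_, ?_, x, y, hxy, not_adj, ⟨e⟩⟩
    · rintro rfl
      rw [cycleGraph_three_eq_top] at not_adj
      exact not_adj hxy
    · simp [Fintype.card_congr e.toEquiv]
  · obtain ⟨a, b, ha, hb, x, y, ⟨e⟩⟩ := hG.exists_iso_joinByPath_cycleGraph_sum hu hv huv
    refine Or.inl ⟨a, b, ha, hb, ?_, x, y, ⟨e⟩⟩
    simp [Fintype.card_congr e.toEquiv]

end IsCubicPair

section Uniqueness

theorem nonempty_iso_joinByPath_cycleGraph_sub_right {n : ℕ} (x y : Fin (n + 2)) (k : ℕ) :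
    Nonempty (joinByPath (cycleGraph (n + 2)) x y k ≃g
      joinByPath (cycleGraph (n + 2)) 0 (y - x) k) := by
  rw [← sub_self x]
  exact nonempty_iso_joinByPath ⟨Equiv.subRight x, by simp [cycleGraph_adj]⟩ x y k

theorem nonempty_iso_joinByPath_cycleGraph_sub_left {n : ℕ} (x y : Fin (n + 2)) (k : ℕ) :
    Nonempty (joinByPath (cycleGraph (n + 2)) x y k ≃g
      joinByPath (cycleGraph (n + 2)) 0 (x - y) k) := by
  rw [← sub_self x]
  exact nonempty_iso_joinByPath ⟨Equiv.subLeft x, by simp [cycleGraph_adj, or_comm]⟩ x y k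

theorem nonempty_iso_joinByPath_cycleGraph_four {x y : Fin 4} (hxy : x ≠ y)
    (hadj : ¬ (cycleGraph 4).Adj x y) (k : ℕ) :
    Nonempty (joinByPath (cycleGraph 4) x y k ≃g joinByPath (cycleGraph 4) 0 2 k) := by
  have sub_eq_two : ∀ x y : Fin 4, x ≠ y → ¬ (cycleGraph 4).Adj x y → y - x = 2 := by decide
  rw [← sub_eq_two x y hxy hadj]
  exact nonempty_iso_joinByPath_cycleGraph_sub_right x y k

theorem nonempty_iso_joinByPath_cycleGraph_five {x y : Fin 5} (hxy : x ≠ y)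
    (hadj : ¬ (cycleGraph 5).Adj x y) (k : ℕ) :
    Nonempty (joinByPath (cycleGraph 5) x y k ≃g joinByPath (cycleGraph 5) 0 2 k) := by
  have sub_eq_two : ∀ x y : Fin 5, x ≠ y → ¬ (cycleGraph 5).Adj x y → y - x = 2 ∨ x - y = 2 := by
    decide
  obtain h | h := sub_eq_two x y hxy hadj <;> rw [← h]
  · exact nonempty_iso_joinByPath_cycleGraph_sub_right x y k
  · exact nonempty_iso_joinByPath_cycleGraph_sub_left x y k

theorem nonempty_iso_joinByPath_cycleGraph_four_five :
    Nonempty (joinByPath (cycleGraph 4) 0 2 2 ≃g joinByPath (cycleGraph 5) 0 2 1) := by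
  refine ⟨⟨⟨Sum.elim ![Sum.inl 0, Sum.inl 1, Sum.inl 2, Sum.inr 0] ![Sum.inl 4, Sum.inl 3],
    Sum.elim ![Sum.inl 0, Sum.inl 1, Sum.inl 2, Sum.inr 1, Sum.inr 0] ![Sum.inl 3],
    by decide, by decide⟩, ?_⟩⟩
  simp only [joinByPath_eq_sup, sup_adj, map_adj', cycleGraph_adj, pathGraph_adj]
  decide

theorem uniqueUpToIso_of_iso {V W : Type*} {S : Set (SimpleGraph V)} (T : SimpleGraph W)
    (h : ∀ G ∈ S, Nonempty (G ≃g T)) : UniqueUpToIso S := by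
  intro G hG H hH
  obtain ⟨e⟩ := h G hG
  obtain ⟨f⟩ := h H hH
  exact ⟨e.trans f.symm⟩

theorem uniqueUpToIso_familyB31_five : UniqueUpToIso (familyB31 5) := by
  refine uniqueUpToIso_of_iso (joinByPath (cycleGraph 5) 0 2 0) ?_
  rintro G ⟨-, x, y, hxy, hadj, ⟨e⟩⟩
  obtain ⟨f⟩ := nonempty_iso_joinByPath_zero (cycleGraph 5) x y
  obtain ⟨g⟩ := nonempty_iso_joinByPath_cycleGraph_five hxy hadj 0
  exact ⟨(e.trans f).trans g⟩

theorem uniqueUpToIso_familyB32_five : UniqueUpToIso (familyB32 5) := by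
  refine uniqueUpToIso_of_iso (joinByPath (cycleGraph 4) 0 2 1) ?_
  rintro G ⟨a, ha, ha', x, y, hxy, hadj, ⟨e⟩⟩
  obtain rfl : a = 4 := by omega
  obtain ⟨g⟩ := nonempty_iso_joinByPath_cycleGraph_four hxy hadj 1
  exact ⟨e.trans g⟩

theorem uniqueUpToIso_familyB32_six : UniqueUpToIso (familyB32 6) := by
  refine uniqueUpToIso_of_iso (joinByPath (cycleGraph 5) 0 2 1) ?_
  rintro G ⟨a, ha, ha', x, y, hxy, hadj, ⟨e⟩⟩
  obtain rfl | rfl : a = 4 ∨ a = 5 := by omega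
  · obtain ⟨f⟩ := nonempty_iso_joinByPath_cycleGraph_four hxy hadj 2
    obtain ⟨g⟩ := nonempty_iso_joinByPath_cycleGraph_four_five
    exact ⟨(e.trans f).trans g⟩
  · obtain ⟨f⟩ := nonempty_iso_joinByPath_cycleGraph_five hxy hadj 1
    exact ⟨e.trans f⟩

end Uniqueness

section Nonempty

variable {n : ℕ}

theorem exists_ne_not_adj_cycleGraph (hn : 4 ≤ n) :
    ∃ x y : Fin n, x ≠ y ∧ ¬ (cycleGraph n).Adj x y := by
  have hlt : (⟨0, by omega⟩ : Fin n) < ⟨2, by omega⟩ := Nat.two_pos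
  refine ⟨_, _, hlt.ne, ?_⟩
  rw [cycleGraph_adj', Fin.coe_sub_iff_lt.mpr hlt, Fin.coe_sub_iff_le.mpr hlt.le]
  dsimp only
  omega

theorem familyB31_nonempty (hn : 4 ≤ n) : (familyB31 n).Nonempty := by
  obtain ⟨x, y, hxy, hadj⟩ := exists_ne_not_adj_cycleGraph hn
  exact ⟨_, hn, x, y, hxy, hadj, ⟨Iso.refl⟩⟩

theorem familyB32_nonempty (hn : 5 ≤ n) : (familyB32 n).Nonempty := by
  obtain ⟨x, y, hxy, hadj⟩ := exists_ne_not_adj_cycleGraph le_rfl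
  have hcard : Fintype.card (Fin 4 ⊕ Fin (n - 4)) = n := by
    simp only [Fintype.card_sum, Fintype.card_fin]; omega
  exact ⟨_, 4, le_rfl, hn, x, y, hxy, hadj, ⟨(overFinIso _ hcard).symm⟩⟩

theorem familyB11_nonempty (hn : 6 ≤ n) : (familyB11 n).Nonempty := by
  have hcard : Fintype.card ((Fin 3 ⊕ Fin (n - 3)) ⊕ Fin 0) = n := by
    simp only [Fintype.card_sum, Fintype.card_fin]; omega
  exact ⟨_, 3, n - 3, le_rfl, by omega, by omega, 0, ⟨0, by omega⟩, ⟨(overFinIso _ hcard).symm⟩⟩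

theorem familyB12_nonempty (hn : 7 ≤ n) : (familyB12 n).Nonempty := by
  have hcard : Fintype.card ((Fin 3 ⊕ Fin 3) ⊕ Fin (n - 3 - 3)) = n := by
    simp only [Fintype.card_sum, Fintype.card_fin]; omega
  exact ⟨_, 3, 3, le_rfl, le_rfl, hn, 0, 0, ⟨(overFinIso _ hcard).symm⟩⟩

theorem familyB11_eq_empty (hn : n < 6) : familyB11 n = ∅ := by
  rw [Set.eq_empty_iff_forall_notMem]
  rintro G ⟨a, b, ha, hb, hab, -⟩
  omega

theorem familyB12_eq_empty (hn : n < 7) : familyB12 n = ∅ := by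
  rw [Set.eq_empty_iff_forall_notMem]
  rintro G ⟨a, b, ha, hb, hab, -⟩
  omega

end Nonempty

section Maximizers

variable {n : ℕ} {G : SimpleGraph (Fin n)}

theorem exists_isCubicPair_of_iso_joinByPath {V W : Type*} [Fintype V] [Fintype W]
    {G : SimpleGraph V} {C : SimpleGraph W} {x y : W} {k : ℕ} (hxy : x ≠ y)
    (hadj : ¬ C.Adj x y) (h : IsCubicPair (joinByPath C x y k) (Sum.inl x) (Sum.inl y))
    (e : G ≃g joinByPath C x y k) : ∃ u v, IsCubicPair G u v ∧ (G.Adj u v ↔ k = 0) := by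
  refine ⟨_, _, h.map_iso e.symm, ?_⟩
  rw [e.symm.map_adj_iff, joinByPath_adj_inl_inl_iff hxy hadj]

theorem mem_familyB11_union_familyB31 :
    G ∈ familyB11 n ∪ familyB31 n ↔ ∃ u v, IsCubicPair G u v ∧ G.Adj u v := by
  constructor
  · rintro (⟨a, b, ha, hb, -, x, y, ⟨e⟩⟩ | ⟨hn, x, y, hxy, hadj, ⟨e⟩⟩)
    · obtain ⟨u, v, h, huv⟩ := exists_isCubicPair_of_iso_joinByPath Sum.inl_ne_inr
        (not_adj_sum_inl_inr x y) (isCubicPair_joinByPath_cycleGraph_sum ha hb x y 0) e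
      exact ⟨u, v, h, huv.mpr rfl⟩
    · obtain ⟨f⟩ := nonempty_iso_joinByPath_zero (cycleGraph n) x y
      obtain ⟨u, v, h, huv⟩ := exists_isCubicPair_of_iso_joinByPath hxy hadj
        (isCubicPair_joinByPath_cycleGraph (by omega) hxy hadj 0) (e.trans f)
      exact ⟨u, v, h, huv.mpr rfl⟩
  · rintro ⟨u, v, h, huv⟩
    obtain ⟨k, hk, h⟩ := h.exists_iso_joinByPath
    obtain rfl := hk.mp huv
    rw [Fintype.card_fin] at h
    obtain ⟨a, b, ha, hb, hab, x, y, e⟩ | ⟨a, ha, rfl, x, y, hxy, hadj, ⟨e⟩⟩ := h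
    · exact Or.inl ⟨a, b, ha, hb, hab, x, y, e⟩
    · obtain ⟨f⟩ := nonempty_iso_joinByPath_zero (cycleGraph a) x y
      exact Or.inr ⟨ha, x, y, hxy, hadj, ⟨e.trans f.symm⟩⟩

theorem mem_familyB12_union_familyB32 :
    G ∈ familyB12 n ∪ familyB32 n ↔ ∃ u v, IsCubicPair G u v ∧ ¬ G.Adj u v := by
  constructor
  · rintro (⟨a, b, ha, hb, hab, x, y, ⟨e⟩⟩ | ⟨a, ha, han, x, y, hxy, hadj, ⟨e⟩⟩)
    · obtain ⟨u, v, h, huv⟩ := exists_isCubicPair_of_iso_joinByPath Sum.inl_ne_inr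
        (not_adj_sum_inl_inr x y) (isCubicPair_joinByPath_cycleGraph_sum ha hb x y _) e
      exact ⟨u, v, h, huv.not.mpr (by omega)⟩
    · obtain ⟨u, v, h, huv⟩ := exists_isCubicPair_of_iso_joinByPath hxy hadj
        (isCubicPair_joinByPath_cycleGraph (by omega) hxy hadj _) e
      exact ⟨u, v, h, huv.not.mpr (by omega)⟩
  · rintro ⟨u, v, h, huv⟩
    obtain ⟨k, hk, h⟩ := h.exists_iso_joinByPath
    have hk : k ≠ 0 := hk.not.mp huv
    rw [Fintype.card_fin] at h
    obtain ⟨a, b, ha, hb, hab, x, y, e⟩ | ⟨a, ha, hak, x, y, hxy, hadj, e⟩ := h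
    · obtain rfl : k = n - a - b := by omega
      exact Or.inl ⟨a, b, ha, hb, by omega, x, y, e⟩
    · obtain rfl : k = n - a := by omega
      exact Or.inr ⟨a, ha, by omega, x, y, hxy, hadj, e⟩

theorem IsCubicPair.mem_bicyclicGraphs {u v : Fin n} (h : IsCubicPair G u v) :
    G ∈ bicyclicGraphs n :=
  ⟨h.connected, by rw [h.ncard_edgeSet, Fintype.card_fin]⟩

theorem sumConnectivityIndex_of_mem_familyB11_union_familyB31
    (hG : G ∈ familyB11 n ∪ familyB31 n) :
    sumConnectivityIndex G = ((n : ℝ) - 4) / 2 + 1 / √6 + 4 / √5 := by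
  obtain ⟨u, v, h, huv⟩ := mem_familyB11_union_familyB31.mp hG
  rw [h.sumConnectivityIndex_eq, if_pos huv, edgeExcess_three_three, Fintype.card_fin]
  ring

theorem sumConnectivityIndex_of_mem_familyB12_union_familyB32
    (hG : G ∈ familyB12 n ∪ familyB32 n) :
    sumConnectivityIndex G = ((n : ℝ) - 5) / 2 + 6 / √5 := by
  obtain ⟨u, v, h, huv⟩ := mem_familyB12_union_familyB32.mp hG
  rw [h.sumConnectivityIndex_eq, if_neg huv, Fintype.card_fin, add_zero]

theorem sumConnectivityIndex_lt_of_notMem (hn : 3 ≤ n) (hG : G ∈ bicyclicGraphs n)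
    (h1 : G ∉ familyB11 n ∪ familyB31 n) (h2 : G ∉ familyB12 n ∪ familyB32 n) :
    sumConnectivityIndex G < ((n : ℝ) - 5) / 2 + 6 / √5 := by
  rw [mem_familyB11_union_familyB31] at h1
  rw [mem_familyB12_union_familyB32] at h2
  rw [← Fintype.card_fin n] at hn
  have hE : G.edgeSet.ncard = Fintype.card (Fin n) + 1 := by rw [hG.2, Fintype.card_fin]
  have hlt := sumConnectivityIndex_lt_of_not_isCubicPair hG.1 hE hn <| by
    rintro ⟨u, v, h⟩
    by_cases huv : G.Adj u v
    · exact h1 ⟨u, v, h, huv⟩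
    · exact h2 ⟨u, v, h, huv⟩
  rwa [Fintype.card_fin] at hlt

theorem second_max_value_lt_max_value (n : ℕ) :
    ((n : ℝ) - 5) / 2 + 6 / √5 < ((n : ℝ) - 4) / 2 + 1 / √6 + 4 / √5 := by
  refine (lt_add_of_pos_right _ edgeExcess_three_three_pos).trans_eq ?_
  rw [edgeExcess_three_three]
  ring

theorem indexMaximizers_eq {V : Type*} [Fintype V] {S F : Set (SimpleGraph V)} {c : ℝ}
    (hFS : F ⊆ S) (hF : F.Nonempty) (hc : ∀ G ∈ F, sumConnectivityIndex G = c)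
    (hlt : ∀ G ∈ S, G ∉ F → sumConnectivityIndex G < c) : indexMaximizers S = F := by
  ext G
  constructor
  · rintro ⟨hG, hmax⟩
    by_contra hGF
    obtain ⟨H, hH⟩ := hF
    exact (hlt G hG hGF).not_ge (hc H hH ▸ hmax H (hFS hH))
  · refine fun hG => ⟨hFS hG, fun H hH => ?_⟩
    rw [hc G hG]
    by_cases hHF : H ∈ F
    · exact (hc H hHF).le
    · exact (hlt H hH hHF).le

theorem indexMaximizers_bicyclicGraphs (hn : 5 ≤ n) :
    indexMaximizers (bicyclicGraphs n) = familyB11 n ∪ familyB31 n := by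
  refine indexMaximizers_eq (fun G hG => ?_) (familyB31_nonempty (by omega)).inr
    (fun G => sumConnectivityIndex_of_mem_familyB11_union_familyB31) fun G hG h1 => ?_
  · obtain ⟨u, v, h, -⟩ := mem_familyB11_union_familyB31.mp hG
    exact h.mem_bicyclicGraphs
  · by_cases h2 : G ∈ familyB12 n ∪ familyB32 n
    · rw [sumConnectivityIndex_of_mem_familyB12_union_familyB32 h2]
      exact second_max_value_lt_max_value n
    · exact (sumConnectivityIndex_lt_of_notMem (by omega) hG h1 h2).trans
        (second_max_value_lt_max_value n)

theorem indexSecondMaximizers_bicyclicGraphs (hn : 5 ≤ n) :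
    indexSecondMaximizers (bicyclicGraphs n) = familyB12 n ∪ familyB32 n := by
  rw [indexSecondMaximizers, indexMaximizers_bicyclicGraphs hn]
  refine indexMaximizers_eq (fun G hG => ⟨?_, fun h1 => ?_⟩) (familyB32_nonempty hn).inr
    (fun G => sumConnectivityIndex_of_mem_familyB12_union_familyB32) fun G hG h2 =>
      sumConnectivityIndex_lt_of_notMem (by omega) hG.1 hG.2 h2
  · obtain ⟨u, v, h, -⟩ := mem_familyB12_union_familyB32.mp hG
    exact h.mem_bicyclicGraphs
  · have hlt := second_max_value_lt_max_value n
    rw [← sumConnectivityIndex_of_mem_familyB11_union_familyB31 h1,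
      ← sumConnectivityIndex_of_mem_familyB12_union_familyB32 hG] at hlt
    exact lt_irrefl _ hlt

end Maximizers

theorem mainTheorem5 (n : ℕ) (hn : 5 ≤ n) :
    -- extremal graphs for n = 5
    (n = 5 →
      indexMaximizers (bicyclicGraphs n) = familyB31 n ∧
      indexSecondMaximizers (bicyclicGraphs n) = familyB32 n ∧
      UniqueUpToIso (familyB31 n) ∧ UniqueUpToIso (familyB32 n)) ∧
    -- extremal graphs for n = 6
    (n = 6 →
      indexMaximizers (bicyclicGraphs n) = familyB11 n ∪ familyB31 n ∧
      indexSecondMaximizers (bicyclicGraphs n) = familyB32 n ∧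
      UniqueUpToIso (familyB32 n)) ∧
    -- extremal graphs for n ≥ 7
    (7 ≤ n →
      indexMaximizers (bicyclicGraphs n) = familyB11 n ∪ familyB31 n ∧
      indexSecondMaximizers (bicyclicGraphs n) = familyB12 n ∪ familyB32 n) ∧
    -- the extremal values
    (∀ G ∈ familyB11 n ∪ familyB31 n,
      sumConnectivityIndex G = ((n : ℝ) - 4) / 2 + 1 / √6 + 4 / √5) ∧
    (∀ H ∈ familyB12 n ∪ familyB32 n,
      sumConnectivityIndex H = ((n : ℝ) - 5) / 2 + 6 / √5) ∧
    -- the families are inhabited in the stated ranges of n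
    (familyB31 n).Nonempty ∧ (familyB32 n).Nonempty ∧
    (6 ≤ n → (familyB11 n).Nonempty) ∧ (7 ≤ n → (familyB12 n).Nonempty) := by
  have hmax := indexMaximizers_bicyclicGraphs hn
  have hsec := indexSecondMaximizers_bicyclicGraphs hn
  refine ⟨?_, ?_, fun _ => ⟨hmax, hsec⟩,
    fun G => sumConnectivityIndex_of_mem_familyB11_union_familyB31,
    fun G => sumConnectivityIndex_of_mem_familyB12_union_familyB32,
    familyB31_nonempty (by omega), familyB32_nonempty hn, familyB11_nonempty,
    familyB12_nonempty⟩
  · rintro rfl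
    rw [familyB11_eq_empty (by norm_num), Set.empty_union] at hmax
    rw [familyB12_eq_empty (by norm_num), Set.empty_union] at hsec
    exact ⟨hmax, hsec, uniqueUpToIso_familyB31_five, uniqueUpToIso_familyB32_five⟩
  · rintro rfl
    rw [familyB12_eq_empty (by norm_num), Set.empty_union] at hsec
    exact ⟨hmax, hsec, uniqueUpToIso_familyB32_six⟩
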